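/- Let $q=p^k>4$ where $p$ is a prime with $p\not\equiv 1\pmod 3$. Let $\mathrm{NG}(q,4)$ be the projective norm graph with vertex set $\mathbb F_{q^3}\times\mathbb F_q^*$, in which two vertices $(A,a)$ and $(B,b)$ are adjacent if and only if $\mathbb N(A+B)=ab$, where $\mathbb N$ is the norm of the extension $\mathbb F_{q^3}/\mathbb F_q$, i.e. $\mathbb N(X)=X\cdot X^{q}\cdot X^{q^2}$ (a vertex may be adjacent to itself; such loops play no role below). Then $\mathrm{NG}(q,4)$ contains the complete bipartite graph $K_{4,6}$ as a subgraph: there are ten distinct vertices $u_1,\dots,u_4,w_1,\dots,w_6$ such that $u_i$ is adjacent to $w_j$ for all $i,j$. In particular, $\mathrm{NG}(2^k,4)$ contains $K_{4,6}$ as a subgraph for every $k\ge 3$, and $\mathrm{NG}(3^\ell,4)$ contains $K_{4,6}$ as a subgraph for every $\ell\ge 2$. -/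

import Mathlib

/-- Adjacency in the projective norm graph `NG(F, K)` of a field extension `K / F`.
The vertices are the elements of `K × Fˣ`, and `(A, a)`, `(B, b)` are adjacent iff `N(A + B) = a b`.
Loops are allowed here: a vertex may be related to itself. -/
def ProjNormAdj (F K : Type*) [Field F] [Field K] [Algebra F K] (v w : K × Fˣ) : Prop :=
  Algebra.norm F (v.1 + w.1) = (v.2 : F) * (w.2 : F)

/-- The projective norm graph `NG(F, K)`, as a simple graph on `K × Fˣ`: two distinct vertices
`(A, a)`, `(B, b)` are joined iff `N(A + B) = a b`. The loop edges are left out, which does not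
change which simple graphs are contained in it as subgraphs. For `|F| = q` and `[K : F] = t - 1`
it is the graph `NG(q, t)`. -/
def projNormGraph (F K : Type*) [Field F] [Field K] [Algebra F K] : SimpleGraph (K × Fˣ) where
  Adj v w := v ≠ w ∧ ProjNormAdj F K v w
  symm := ⟨fun v w h => ⟨h.1.symm, by
    have h2 := h.2
    unfold ProjNormAdj at h2 ⊢
    rw [add_comm, h2, mul_comm]⟩⟩
  loopless := ⟨fun _ h => h.1 rfl⟩

/-!
For every finite field `F` with more than four elements, `K_{4,6}` is found in the norm graph of the
cubic extension `K / F`. Sending one vertex of the four to infinity by an inversion and translating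
(`isContained_of_norm_add_eq`), a copy of `K_{4,6}` amounts to three points `P i` of
`K` such that a system `N(Z + P i) = α i` with nonzero right-hand sides has six solutions `Z`. Such
systems are written down explicitly, starting from a single element `f` of `K`, not in
`F`, with `f³ - f = a ∈ F`. It exists because `x ↦ x³ - x` takes the same value at `0` and `1`, hence
misses a value `a` of `F`, and because `K` contains a root of every irreducible cubic
(`exists_cube_sub_self_eq`). The conjugates `f, f₂, f₃` of `f` have sum `0` and product `a`, satisfy
`f² + f f₂ + f₂² = 1`, and `N(f + b) = b³ - b + a` for `b ∈ F`.

* If `2` and `3` are invertible, the system `N(Z) = a`, `N(Z + f) = N(Z + f₂) = -a` is solved by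
  `f₃`, `f₃ + 1`, `f₃ - 1`, `f f₂ / f₃`, `f₂ (f₃ - f) / (f₂ - f₃)` and `f (f₂ - f₃) / (f₃ - f)`.
  After adding `0`, `f` or `f₂`, each of them is, up to sign, a conjugate of `f` or `f ± 1` times a
  quotient of elements of equal norm.
* In characteristic three these solutions are not distinct. There `σ f = f + 1`, and every linear
  polynomial in `f` over `F` has trace zero. If `w` or `w⁻¹` has trace zero, then
  `N(σ w / w) = 1` and `N(σ w / w + 1) = -1`; the latter for `d w` reads
  `N(σ w / w + d / σ d) = -1`. So it suffices to find a `d` and six elements `w`, no two of them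
  proportional over `F`, such that both `w` and `d w` are, up to inversion, linear polynomials in
  `f`; this is possible for `d = f (a - f)` when `a ≠ ±1`.
* In characteristic two let `g = f + 1`. The inverses `c` of its three conjugates have sum zero and
  characteristic polynomial `T³ + n T + n` with `n = 1 / a`. The system `N(Z + c) = 1`, over these
  three `c`, is solved by the three elements `1 + c`, and by `1`, `r`, `r + 1` where
  `r² + r = n + 1`; the solution `r` of this equation is a cyclic sum in the conjugates of `g`, hence
  lies in `F`. These six are distinct when `a ≠ 1`.
-/

/-! ### Cubic extensions and the reduction to three norm equations -/

/-- An automorphism `σ` of the cubic extension `K / F` that generates its Galois group: `σ` has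
order dividing three, its fixed field is `F`, and the norm is the product over the orbit of `σ`. -/
structure IsCubicGenerator {F K : Type*} [Field F] [Field K] [Algebra F K] (σ : K ≃ₐ[F] K) :
    Prop where
  norm_eq : ∀ z, algebraMap F K (Algebra.norm F z) = z * σ z * σ (σ z)
  cube : ∀ z, σ (σ (σ z)) = z
  fixed : ∀ z, σ z = z → z ∈ Set.range (algebraMap F K)

theorem injective_six {α : Type*} {z₀ z₁ z₂ z₃ z₄ z₅ : α} (h01 : z₀ ≠ z₁) (h02 : z₀ ≠ z₂)
    (h03 : z₀ ≠ z₃) (h04 : z₀ ≠ z₄) (h05 : z₀ ≠ z₅) (h12 : z₁ ≠ z₂) (h13 : z₁ ≠ z₃)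
    (h14 : z₁ ≠ z₄) (h15 : z₁ ≠ z₅) (h23 : z₂ ≠ z₃) (h24 : z₂ ≠ z₄) (h25 : z₂ ≠ z₅)
    (h34 : z₃ ≠ z₄) (h35 : z₃ ≠ z₅) (h45 : z₄ ≠ z₅) :
    Function.Injective ![z₀, z₁, z₂, z₃, z₄, z₅] := by
  have := h01.symm; have := h02.symm; have := h03.symm; have := h04.symm; have := h05.symm
  have := h12.symm; have := h13.symm; have := h14.symm; have := h15.symm; have := h23.symm
  have := h24.symm; have := h25.symm; have := h34.symm; have := h35.symm; have := h45.symm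
  intro i j
  fin_cases i <;> fin_cases j <;> simp [*]

theorem injective_three {α : Type*} {z₀ z₁ z₂ : α} (h01 : z₀ ≠ z₁) (h02 : z₀ ≠ z₂)
    (h12 : z₁ ≠ z₂) : Function.Injective ![z₀, z₁, z₂] := by
  have := h01.symm; have := h02.symm; have := h12.symm
  intro i j
  fin_cases i <;> fin_cases j <;> simp [*]

section Cubic

variable {F K : Type*} [Field F] [Field K] [Algebra F K]

theorem exists_notMem_of_card_le {α : Type*} [Finite α] (S : Finset α) {n : ℕ} (hS : S.card ≤ n)
    (hn : n < Nat.card α) : ∃ s, s ∉ S := by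
  have := Fintype.ofFinite α
  rw [Nat.card_eq_fintype_card] at hn
  by_contra! hc
  rw [Finset.eq_univ_iff_forall.2 hc, Finset.card_univ] at hS
  omega

theorem exists_isCubicGenerator [Finite F] (h3 : Module.finrank F K = 3) :
    ∃ σ : K ≃ₐ[F] K, IsCubicGenerator σ := by
  have : Module.Finite F K := Module.finite_of_finrank_pos (by omega)
  have : Finite K := Module.finite_of_finite F
  have := Fintype.ofFinite F
  have hσ : ∀ z : K, FiniteField.frobeniusAlgEquivOfAlgebraic F K z = z ^ Nat.card F := by
    intro z
    rw [FiniteField.coe_frobeniusAlgEquivOfAlgebraic, Fintype.card_eq_nat_card]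
  have hcube : ∀ z : K, FiniteField.frobeniusAlgEquivOfAlgebraic F K
      (FiniteField.frobeniusAlgEquivOfAlgebraic F K
        (FiniteField.frobeniusAlgEquivOfAlgebraic F K z)) = z := by
    intro z
    have h := pow_orderOf_eq_one (FiniteField.frobeniusAlgEquivOfAlgebraic F K)
    rw [FiniteField.orderOf_frobeniusAlgEquivOfAlgebraic, h3] at h
    exact DFunLike.congr_fun h z
  refine ⟨FiniteField.frobeniusAlgEquivOfAlgebraic F K, ?_, hcube, ?_⟩
  · intro z
    rw [FiniteField.algebraMap_norm_eq_prod_pow, h3]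
    simp only [Finset.prod_range_succ, Finset.prod_range_zero, one_mul, pow_zero, pow_one, hσ]
    rw [← pow_mul, sq]
  · intro z hz
    have hp : z ^ Nat.card F = z := (hσ z).symm.trans hz
    -- every element of the Galois group is a power of Frobenius, hence fixes `z`
    refine (IsGalois.mem_range_algebraMap_iff_fixed z).2 fun g => ?_
    obtain ⟨n, rfl⟩ := (FiniteField.bijective_frobeniusAlgEquivOfAlgebraic_pow F K).2 g
    simp only [AlgEquiv.coe_pow]
    exact Function.iterate_fixed hz _

namespace IsCubicGenerator


theorem norm_neg {σ : K ≃ₐ[F] K} (h : IsCubicGenerator σ) (z : K) :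
    Algebra.norm F (-z) = -Algebra.norm F z := by
  apply (algebraMap F K).injective
  simp only [h.norm_eq, map_neg (algebraMap F K), map_neg σ]
  ring

theorem norm_apply {σ : K ≃ₐ[F] K} (h : IsCubicGenerator σ) (z : K) :
    Algebra.norm F (σ z) = Algebra.norm F z := by
  apply (algebraMap F K).injective
  rw [h.norm_eq, h.norm_eq, h.cube]
  ring

theorem sq {σ : K ≃ₐ[F] K} (h : IsCubicGenerator σ) : IsCubicGenerator (σ.trans σ) where
  norm_eq z := by
    simp only [AlgEquiv.trans_apply, h.cube, h.norm_eq z]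
    ring
  cube z := by simp only [AlgEquiv.trans_apply, h.cube]
  fixed z hz := by
    refine h.fixed z ?_
    conv_lhs => rw [← hz]
    exact h.cube z

end IsCubicGenerator

theorem algebraNorm_inv [Module.Finite F K] (z : K) : Algebra.norm F z⁻¹ = (Algebra.norm F z)⁻¹ := by
  rcases eq_or_ne z 0 with rfl | hz
  · simp
  · refine eq_inv_of_mul_eq_one_left ?_
    rw [← map_mul, inv_mul_cancel₀ hz, map_one]

theorem algebraNorm_div [Module.Finite F K] (z w : K) :
    Algebra.norm F (z / w) = Algebra.norm F z / Algebra.norm F w := by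
  rw [div_eq_mul_inv, map_mul, algebraNorm_inv, div_eq_mul_inv]

/-- Once the norms of all sums `A i + X j` factor as `a i * x j`, a translation `A + c`, `X - c`
separates the two sides of the complete bipartite graph. -/
theorem isContained_of_norm_add_eq_mul (hK : 24 < Nat.card K)
    (A : Fin 4 → K) (hA : A.Injective) (X : Fin 6 → K) (hX : X.Injective)
    (a : Fin 4 → Fˣ) (x : Fin 6 → Fˣ)
    (hAX : ∀ i j, Algebra.norm F (A i + X j) = (a i : F) * (x j : F)) :
    (completeBipartiteGraph (Fin 4) (Fin 6)).IsContained (projNormGraph F K) := by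
  classical
  have : Finite K := Nat.finite_of_card_ne_zero (by omega)
  obtain ⟨c, hc⟩ := exists_notMem_of_card_le
    (Finset.univ.image fun ij : Fin 4 × Fin 6 => (X ij.2 - A ij.1) / 2)
    (Finset.card_image_le.trans (by simp)) hK
  have hne0 : ∀ i j, A i + X j ≠ 0 := by
    intro i j h0
    have h1 := hAX i j
    rw [h0] at h1
    have : Algebra.norm F (0 : K) ≠ 0 := by
      rw [h1]; exact mul_ne_zero (a i).ne_zero (x j).ne_zero
    exact this Algebra.norm_zero
  have hne : ∀ i j, A i + c ≠ X j - c := by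
    intro i j h
    by_cases h2 : (2 : K) = 0
    · exact hne0 i j (by linear_combination -h + (A i + c) * h2)
    · refine hc (Finset.mem_image.2 ⟨(i, j), Finset.mem_univ _, ?_⟩)
      rw [div_eq_iff h2]
      linear_combination -h
  have hadj : ∀ i j, ProjNormAdj F K (A i + c, a i) (X j - c, x j) := by
    intro i j
    have : A i + c + (X j - c) = A i + X j := by ring
    simp only [ProjNormAdj, this, hAX]
  let g : Fin 4 ⊕ Fin 6 → K × Fˣ :=
    Sum.elim (fun i => (A i + c, a i)) (fun j => (X j - c, x j))
  have hg : ∀ i j, (projNormGraph F K).Adj (g (Sum.inl i)) (g (Sum.inr j)) := fun i j =>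
    ⟨fun h => hne i j (congrArg Prod.fst h), hadj i j⟩
  refine ⟨⟨⟨g, ?_⟩, ?_⟩⟩
  · rintro (i | j) (i' | j') h
    · simp at h
    · exact hg i j'
    · exact (hg i' j).symm
    · simp at h
  · rintro (i | j) (i' | j') h
    · exact congrArg Sum.inl (hA (add_right_cancel (congrArg Prod.fst h)))
    · exact absurd (congrArg Prod.fst h) (hne i j')
    · exact absurd (congrArg Prod.fst h).symm (hne i' j)
    · exact congrArg Sum.inr (hX (sub_left_injective (congrArg Prod.fst h)))

/-- Three points `P i` whose norm conditions `N(Z + P i) = α i` have six common solutions give a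
copy of `K_{4,6}`. The fourth vertex on the small side is the point at infinity, brought
to a finite position by the inversion `u ↦ 1 / (u - s)`. -/
theorem isContained_of_norm_add_eq [Finite F] (hF : 4 < Nat.card F) (h3 : Module.finrank F K = 3)
    (P : Fin 3 → K) (hP : P.Injective) (Z : Fin 6 → K) (hZ : Z.Injective)
    (α : Fin 3 → F) (hα : ∀ i, α i ≠ 0) (hPZ : ∀ i j, Algebra.norm F (Z j + P i) = α i) :
    (completeBipartiteGraph (Fin 4) (Fin 6)).IsContained (projNormGraph F K) := by
  classical
  have : Module.Finite F K := Module.finite_of_finrank_pos (by omega)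
  have : Finite K := Module.finite_of_finite F
  have hK : 24 < Nat.card K := by
    rw [Module.natCard_eq_pow_finrank (K := F), h3]
    calc 24 < 5 ^ 3 := by norm_num
      _ ≤ Nat.card F ^ 3 := Nat.pow_le_pow_left hF 3
  obtain ⟨s, hs⟩ := exists_notMem_of_card_le
    (Finset.univ.image P ∪ Finset.univ.image fun j => -Z j)
    ((Finset.card_union_le _ _).trans
      (add_le_add Finset.card_image_le Finset.card_image_le)) (by simp; omega)
  simp only [Finset.mem_union, Finset.mem_image, Finset.mem_univ, true_and, not_or,
    not_exists] at hs
  have hPs : ∀ i, P i - s ≠ 0 := fun i h => hs.1 i (sub_eq_zero.1 h)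
  have hZs : ∀ j, Z j + s ≠ 0 := fun j h => hs.2 j (by linear_combination -h)
  have hN : ∀ z : K, z ≠ 0 → Algebra.norm F z ≠ 0 := fun z hz => Algebra.norm_ne_zero_iff.2 hz
  refine isContained_of_norm_add_eq_mul hK
    (Fin.cons 0 fun i => (P i - s)⁻¹) ?_ (fun j => (Z j + s)⁻¹) ?_
    (Fin.cons 1 fun i => Units.mk0 (α i / Algebra.norm F (P i - s))
      (div_ne_zero (hα i) (hN _ (hPs i))))
    (fun j => Units.mk0 (Algebra.norm F (Z j + s))⁻¹ (inv_ne_zero (hN _ (hZs j)))) ?_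
  · rw [Fin.cons_injective_iff]
    refine ⟨?_, fun i j h => hP (sub_left_injective (inv_injective h))⟩
    rintro ⟨i, hi⟩
    exact inv_ne_zero (hPs i) hi
  · exact fun i j h => hZ (add_left_injective s (inv_injective h))
  · intro i j
    refine Fin.cases ?_ (fun i => ?_) i
    · simp [algebraNorm_inv]
    · have key : (P i - s)⁻¹ + (Z j + s)⁻¹ = (Z j + P i) * ((P i - s)⁻¹ * (Z j + s)⁻¹) := by
        have := hPs i
        have := hZs j
        field_simp
        ring
      simp only [Fin.cons_succ, Units.val_mk0, key, map_mul, algebraNorm_inv, hPZ]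
      ring

/-! ### An element whose cube differs from it by a scalar -/

/-- Over a finite field a value missed by `x ↦ x³ - x` is taken in the cubic extension: the
polynomial `X³ - X - a` has no root, hence is irreducible, and there is only one cubic
extension. -/
theorem exists_cube_sub_self_eq [Finite F] (h3 : Module.finrank F K = 3) (a : F)
    (ha : ∀ x : F, x ^ 3 - x ≠ a) :
    ∃ f : K, f ^ 3 - f = algebraMap F K a ∧ f ∉ Set.range (algebraMap F K) := by
  have : Module.Finite F K := Module.finite_of_finrank_pos (by omega)
  have : Finite K := Module.finite_of_finite F
  let p : Polynomial F := Polynomial.X ^ 3 - Polynomial.X - Polynomial.C a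
  have hdeg : p.natDegree = 3 := by simp only [p]; compute_degree!
  have hirr : Irreducible p := by
    refine Polynomial.irreducible_of_degree_le_three_of_not_isRoot (by simp [hdeg]) fun x hx => ?_
    simp only [p, Polynomial.IsRoot, Polynomial.eval_sub, Polynomial.eval_pow, Polynomial.eval_X,
      Polynomial.eval_C, sub_eq_zero] at hx
    exact ha x hx
  have := Fact.mk hirr
  have hfin : Module.finrank F (AdjoinRoot p) = 3 := by
    rw [(AdjoinRoot.powerBasis hirr.ne_zero).finrank, AdjoinRoot.powerBasis_dim, hdeg]
  have : Module.Finite F (AdjoinRoot p) := Module.finite_of_finrank_pos (by omega)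
  have : Finite (AdjoinRoot p) := Module.finite_of_finite F
  obtain ⟨φ⟩ := FiniteField.nonempty_algHom_of_finrank_dvd (F := F) (K := AdjoinRoot p) (L := K)
    (by rw [hfin, h3])
  have hroot : φ (AdjoinRoot.root p) ^ 3 - φ (AdjoinRoot.root p) = algebraMap F K a := by
    have h := AdjoinRoot.eval₂_root p
    simp only [p, Polynomial.eval₂_sub, Polynomial.eval₂_pow, Polynomial.eval₂_X,
      Polynomial.eval₂_C, sub_eq_zero] at h
    rw [← map_pow, ← map_sub]
    erw [h]
    exact φ.commutes a
  refine ⟨φ (AdjoinRoot.root p), hroot, ?_⟩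
  rintro ⟨x, hx⟩
  rw [← hx, ← map_pow, ← map_sub] at hroot
  exact ha x ((algebraMap F K).injective hroot)

namespace IsCubicGenerator

theorem apply_ne {σ : K ≃ₐ[F] K} (h : IsCubicGenerator σ) {f : K}
    (hf : f ∉ Set.range (algebraMap F K)) : σ f ≠ f := fun hσ => hf (h.fixed f hσ)

/-- Subtracting the equations `f³ - f = a` of two conjugates. -/
theorem sq_add_mul_add_sq {σ : K ≃ₐ[F] K} (h : IsCubicGenerator σ) {f : K} {a : F}
    (hfa : f ^ 3 - f = algebraMap F K a) (hf : f ∉ Set.range (algebraMap F K)) :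
    f ^ 2 + f * σ f + σ f ^ 2 = 1 := by
  have h1 : σ f ^ 3 - σ f = algebraMap F K a := by
    rw [← map_pow, ← map_sub, hfa, AlgEquiv.commutes]
  refine mul_left_cancel₀ (sub_ne_zero.2 (h.apply_ne hf)) ?_
  linear_combination h1 - hfa

theorem apply_apply_eq {σ : K ≃ₐ[F] K} (h : IsCubicGenerator σ) {f : K} {a : F}
    (hfa : f ^ 3 - f = algebraMap F K a) (hf : f ∉ Set.range (algebraMap F K)) :
    σ (σ f) = -f - σ f := by
  have h1 := h.sq_add_mul_add_sq hfa hf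
  have h2 := congrArg σ h1
  simp only [map_add, map_mul, map_pow, map_one] at h2
  have h13 : σ (σ f) - f ≠ 0 := by
    refine sub_ne_zero.2 fun h0 => h.apply_ne hf ?_
    have := h.cube f
    rwa [h0] at this
  apply mul_left_cancel₀ h13
  linear_combination h2 - h1

theorem norm_eq_of_cube_sub_self {σ : K ≃ₐ[F] K} (h : IsCubicGenerator σ) {f : K} {a : F}
    (hfa : f ^ 3 - f = algebraMap F K a) (hf : f ∉ Set.range (algebraMap F K)) (b : F) :
    Algebra.norm F (f + algebraMap F K b) = b ^ 3 - b + a := by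
  apply (algebraMap F K).injective
  have h1 := h.sq_add_mul_add_sq hfa hf
  rw [h.norm_eq]
  simp only [map_add, map_sub, map_pow, AlgEquiv.commutes, h.apply_apply_eq hfa hf, ← hfa]
  linear_combination (-f - algebraMap F K b) * h1

end IsCubicGenerator

end Cubic

/-! ### Values missed by `x ↦ x³ - x` -/

section Existence

variable {F : Type*} [Field F]

theorem exists_pow_ne_self [Finite F] {n : ℕ} (hn : 1 < n) (hF : n < Nat.card F) :
    ∃ s : F, s ^ n ≠ s := by
  have hdeg : (Polynomial.X ^ n - Polynomial.X : Polynomial F).natDegree = n :=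
    FiniteField.X_pow_card_sub_X_natDegree_eq F hn
  obtain ⟨s, hs⟩ := Polynomial.exists_eval_ne_zero_of_natDegree_lt_card
    (Polynomial.X ^ n - Polynomial.X : Polynomial F)
    (FiniteField.X_pow_card_sub_X_ne_zero F hn)
    (by rw [hdeg, ← Nat.cast_card]; exact_mod_cast hF)
  refine ⟨s, fun h => hs ?_⟩
  rw [Polynomial.eval_sub, Polynomial.eval_pow, Polynomial.eval_X, h, sub_self]

theorem exists_forall_cube_sub_self_ne [Finite F] : ∃ a : F, ∀ x : F, x ^ 3 - x ≠ a := by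
  -- `0` and `1` have the same image, so the map is not injective, hence not surjective
  by_contra! hc
  exact zero_ne_one
    ((Finite.injective_iff_surjective.2 hc) (by ring : (0 : F) ^ 3 - 0 = 1 ^ 3 - 1))

/-- In characteristic three `x ↦ x³ - x` is additive. If `1` is not in its image, the translate by
`1` of a nonzero element of the image is missed too. -/
theorem exists_forall_cube_sub_self_ne_of_three_eq_zero [Finite F] (hF : 4 < Nat.card F)
    (h3 : (3 : F) = 0) :
    ∃ a : F, a ≠ 1 ∧ a ≠ -1 ∧ ∀ x : F, x ^ 3 - x ≠ a := by
  by_cases h1 : ∃ y : F, y ^ 3 - y = 1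
  · obtain ⟨y, hy⟩ := h1
    obtain ⟨a, ha⟩ := exists_forall_cube_sub_self_ne (F := F)
    refine ⟨a, fun h => ha y (by rw [hy, h]), fun h => ha (-y) (by rw [h]; linear_combination -hy),
      ha⟩
  · obtain ⟨s, hs⟩ := exists_pow_ne_self (F := F) (n := 3) (by norm_num) (by omega)
    push Not at h1
    refine ⟨1 + (s ^ 3 - s), fun h => hs (by linear_combination h), fun h => h1 s ?_, fun x hx => ?_⟩
    · linear_combination h - h3
    · refine h1 (x - s) ?_
      linear_combination hx + (-x ^ 2 * s + x * s ^ 2) * h3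

/-- In characteristic two there are `x ≠ y` with `x³ - x = y³ - y`, both different from `0` and
`1`, coming from a rational parametrization of the conic `x² + x y + y² = 1`. So `x ↦ x³ - x` misses
more than one value. -/
theorem exists_forall_cube_sub_self_ne_of_two_eq_zero [Finite F] (hF : 4 < Nat.card F)
    (h2 : (2 : F) = 0) :
    ∃ a : F, a ≠ 1 ∧ ∀ x : F, x ^ 3 - x ≠ a := by
  classical
  obtain ⟨s, hs⟩ := exists_pow_ne_self (F := F) (n := 4) (by norm_num) hF
  have s0 : s ≠ 0 := by rintro rfl; simp at hs
  have s1 : s ≠ 1 := by rintro rfl; simp at hs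
  have sq : 1 + s + s ^ 2 ≠ 0 := fun h => hs (by linear_combination (s ^ 2 - s) * h)
  obtain ⟨x, hx⟩ : ∃ x, x = (s ^ 2 + 1) / (1 + s + s ^ 2) := ⟨_, rfl⟩
  obtain ⟨y, hy⟩ : ∃ y, y = s ^ 2 / (1 + s + s ^ 2) := ⟨_, rfl⟩
  have hxy : x ≠ y := by
    rw [hx, hy, ne_eq, div_left_inj' sq]
    exact fun h => one_ne_zero (α := F) (by linear_combination h)
  have hy0 : y ≠ 0 := by rw [hy]; exact div_ne_zero (pow_ne_zero _ s0) sq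
  have hy1 : y ≠ 1 := by
    rw [hy, ne_eq, div_eq_one_iff_eq sq]
    exact fun h => s1 (by linear_combination -h - h2)
  have hcol : x ^ 3 - x = y ^ 3 - y := by
    have : x ^ 2 + x * y + y ^ 2 = 1 := by
      rw [hx, hy]
      field_simp
      linear_combination (s ^ 4 - s ^ 3 - s) * h2
    linear_combination (x - y) * this
  by_contra! hc
  -- sending `y` to `1` instead gives a surjective map that still identifies `0` and `1`
  have hsurj : Function.Surjective fun t : F => if t = y then 1 else t ^ 3 - t := by
    intro a
    by_cases ha : a = 1
    · exact ⟨y, by simp [ha]⟩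
    · obtain ⟨t, ht⟩ := hc a ha
      by_cases hty : t = y
      · exact ⟨x, (if_neg hxy).trans (by rw [hcol, ← hty, ht])⟩
      · exact ⟨t, by simp only [if_neg hty, ht]⟩
  refine zero_ne_one (α := F) (Finite.injective_iff_surjective.2 hsurj ?_)
  simp [hy0.symm, hy1.symm]

end Existence

/-! ### Characteristic different from two and three -/

section Generic

variable {F K : Type*} [Field F] [Field K] [Algebra F K]

theorem isContained_of_two_ne_zero_of_three_ne_zero [Finite F] (hF : 4 < Nat.card F)
    (h3 : Module.finrank F K = 3) (h2F : (2 : F) ≠ 0) (h3F : (3 : F) ≠ 0) :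
    (completeBipartiteGraph (Fin 4) (Fin 6)).IsContained (projNormGraph F K) := by
  have : Module.Finite F K := Module.finite_of_finrank_pos (by omega)
  obtain ⟨σ, h⟩ := exists_isCubicGenerator h3
  obtain ⟨a, ha⟩ := exists_forall_cube_sub_self_ne (F := F)
  have ha0 : a ≠ 0 := fun h0 => ha 0 (by rw [h0]; ring)
  obtain ⟨f, hfa, hf⟩ := exists_cube_sub_self_eq h3 a ha
  have hN := h.norm_eq_of_cube_sub_self hfa hf
  have hq := h.sq_add_mul_add_sq hfa hf
  have hs := h.apply_apply_eq hfa hf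
  have h2 : (2 : K) ≠ 0 := by
    rw [← map_ofNat (algebraMap F K) 2]; exact (map_ne_zero _).2 h2F
  have h3K : (3 : K) ≠ 0 := by
    rw [← map_ofNat (algebraMap F K) 3]; exact (map_ne_zero _).2 h3F
  obtain ⟨f₂, hf₂⟩ : ∃ f₂, f₂ = σ f := ⟨_, rfl⟩
  obtain ⟨f₃, hf₃⟩ : ∃ f₃, f₃ = σ f₂ := ⟨_, rfl⟩
  have hσ₃ : σ f₃ = f := by rw [hf₃, hf₂, h.cube]
  have hsum : f + f₂ + f₃ = 0 := by rw [hf₃, hf₂, hs]; ring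
  rw [← hf₂] at hq
  have hp : f * f₂ = f₃ ^ 2 - 1 := by
    linear_combination -hq + (f + f₂ - f₃) * hsum
  -- norms of the conjugates, of their shifts by `±1`, and of their differences
  have n₁ : Algebra.norm F f = a := by simpa using hN 0
  have n₂ : Algebra.norm F f₂ = a := by rw [hf₂, h.norm_apply, n₁]
  have n₃ : Algebra.norm F f₃ = a := by rw [hf₃, h.norm_apply, n₂]
  have p₁ : Algebra.norm F (f + 1) = a := by simpa using hN 1
  have p₂ : Algebra.norm F (f₂ + 1) = a := by
    rw [← p₁, ← h.norm_apply (f + 1), map_add σ, map_one σ, hf₂]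
  have p₃ : Algebra.norm F (f₃ + 1) = a := by
    rw [← p₂, ← h.norm_apply (f₂ + 1), map_add σ, map_one σ, hf₃]
  have m₁ : Algebra.norm F (f - 1) = a := by
    have := hN (-1)
    rw [map_neg, map_one, ← sub_eq_add_neg] at this
    rw [this]; ring
  have m₂ : Algebra.norm F (f₂ - 1) = a := by
    rw [← m₁, ← h.norm_apply (f - 1), map_sub σ, map_one σ, hf₂]
  have m₃ : Algebra.norm F (f₃ - 1) = a := by
    rw [← m₂, ← h.norm_apply (f₂ - 1), map_sub σ, map_one σ, hf₃]
  have hg₁ : f - f₂ ≠ 0 := by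
    rw [hf₂]; exact sub_ne_zero.2 (h.apply_ne hf).symm
  have hg₂ : f₂ - f₃ ≠ 0 := by
    rw [hf₃, hf₂, ← map_sub, ← hf₂]; exact (map_ne_zero σ).2 hg₁
  have hg₃ : f₃ - f ≠ 0 := by
    rw [← hσ₃, hf₃, ← map_sub, ← hf₃]; exact (map_ne_zero σ).2 hg₂
  obtain ⟨G, hG⟩ : ∃ G, G = Algebra.norm F (f - f₂) := ⟨_, rfl⟩
  have hG0 : G ≠ 0 := by rw [hG]; exact Algebra.norm_ne_zero_iff.2 hg₁
  have hG₂ : Algebra.norm F (f₂ - f₃) = G := by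
    rw [hG, ← h.norm_apply (f - f₂), map_sub σ, ← hf₂, hf₃]
  have hG₃ : Algebra.norm F (f₃ - f) = G := by
    rw [← hG₂, ← h.norm_apply (f₂ - f₃), map_sub σ, ← hf₃, hσ₃]
  rw [eq_comm] at hG
  have z₁ : f ≠ 0 := fun h0 => hf ⟨0, by rw [h0, map_zero]⟩
  have z₂ : f₂ ≠ 0 := by rw [hf₂]; exact (map_ne_zero σ).2 z₁
  have z₃ : f₃ ≠ 0 := by rw [hf₃]; exact (map_ne_zero σ).2 z₂
  -- the six solutions of `N(z) = a`, `N(z + f) = -a`, `N(z + f₂) = -a`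
  have s₀ : Algebra.norm F f₃ = a ∧ Algebra.norm F (f₃ + f) = -a ∧
      Algebra.norm F (f₃ + f₂) = -a := by
    refine ⟨n₃, ?_, ?_⟩
    · rw [show f₃ + f = -f₂ by linear_combination hsum, h.norm_neg, n₂]
    · rw [show f₃ + f₂ = -f by linear_combination hsum, h.norm_neg, n₁]
  have s₁ : Algebra.norm F (f₃ + 1) = a ∧ Algebra.norm F (f₃ + 1 + f) = -a ∧
      Algebra.norm F (f₃ + 1 + f₂) = -a := by
    refine ⟨p₃, ?_, ?_⟩
    · rw [show f₃ + 1 + f = -(f₂ - 1) by linear_combination hsum, h.norm_neg, m₂]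
    · rw [show f₃ + 1 + f₂ = -(f - 1) by linear_combination hsum, h.norm_neg, m₁]
  have s₂ : Algebra.norm F (f₃ - 1) = a ∧ Algebra.norm F (f₃ - 1 + f) = -a ∧
      Algebra.norm F (f₃ - 1 + f₂) = -a := by
    refine ⟨m₃, ?_, ?_⟩
    · rw [show f₃ - 1 + f = -(f₂ + 1) by linear_combination hsum, h.norm_neg, p₂]
    · rw [show f₃ - 1 + f₂ = -(f + 1) by linear_combination hsum, h.norm_neg, p₁]
  have s₃ : Algebra.norm F (f * f₂ / f₃) = a ∧ Algebra.norm F (f * f₂ / f₃ + f) = -a ∧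
      Algebra.norm F (f * f₂ / f₃ + f₂) = -a := by
    refine ⟨?_, ?_, ?_⟩
    · rw [algebraNorm_div, map_mul, n₁, n₂, n₃, mul_div_cancel_right₀ _ ha0]
    · rw [show f * f₂ / f₃ + f = -(f * f / f₃) by
        field_simp; linear_combination hsum, h.norm_neg, algebraNorm_div, map_mul, n₁, n₃,
        mul_div_cancel_right₀ _ ha0]
    · rw [show f * f₂ / f₃ + f₂ = -(f₂ * f₂ / f₃) by
        field_simp; linear_combination hsum, h.norm_neg, algebraNorm_div, map_mul, n₂, n₃,
        mul_div_cancel_right₀ _ ha0]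
  have s₄ : Algebra.norm F (f₂ * (f₃ - f) / (f₂ - f₃)) = a ∧
      Algebra.norm F (f₂ * (f₃ - f) / (f₂ - f₃) + f) = -a ∧
      Algebra.norm F (f₂ * (f₃ - f) / (f₂ - f₃) + f₂) = -a := by
    refine ⟨?_, ?_, ?_⟩
    · rw [algebraNorm_div, map_mul, n₂, hG₂, hG₃, mul_div_cancel_right₀ _ hG0]
    · rw [show f₂ * (f₃ - f) / (f₂ - f₃) + f = -(f₃ * (f - f₂) / (f₂ - f₃)) by
        field_simp; ring, h.norm_neg, algebraNorm_div, map_mul, n₃, hG, hG₂,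
        mul_div_cancel_right₀ _ hG0]
    · rw [show f₂ * (f₃ - f) / (f₂ - f₃) + f₂ = -(f₂ * (f - f₂) / (f₂ - f₃)) by
        field_simp; ring, h.norm_neg, algebraNorm_div, map_mul, n₂, hG, hG₂,
        mul_div_cancel_right₀ _ hG0]
  have s₅ : Algebra.norm F (f * (f₂ - f₃) / (f₃ - f)) = a ∧
      Algebra.norm F (f * (f₂ - f₃) / (f₃ - f) + f) = -a ∧
      Algebra.norm F (f * (f₂ - f₃) / (f₃ - f) + f₂) = -a := by
    refine ⟨?_, ?_, ?_⟩
    · rw [algebraNorm_div, map_mul, n₁, hG₂, hG₃, mul_div_cancel_right₀ _ hG0]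
    · rw [show f * (f₂ - f₃) / (f₃ - f) + f = -(f * (f - f₂) / (f₃ - f)) by
        field_simp; ring, h.norm_neg, algebraNorm_div, map_mul, n₁, hG, hG₃,
        mul_div_cancel_right₀ _ hG0]
    · rw [show f * (f₂ - f₃) / (f₃ - f) + f₂ = -(f₃ * (f - f₂) / (f₃ - f)) by
        field_simp; ring, h.norm_neg, algebraNorm_div, map_mul, n₃, hG, hG₃,
        mul_div_cancel_right₀ _ hG0]
  have e₁ : f * f₂ ≠ f₃ ^ 2 := by
    rw [hp]; intro e; exact one_ne_zero (α := K) (by linear_combination -e)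
  have e₂ : ∀ b : F, f₃ ≠ algebraMap F K b := by
    intro b hb
    refine hf ⟨b, ?_⟩
    rw [← hσ₃, hb, AlgEquiv.commutes]
  -- consecutive differences of conjugates are not in `F`, as their sum `0` would be `3 * b`
  have e₃ : ∀ b : F, b ≠ 0 → f₂ - f₃ ≠ algebraMap F K b ∧ f₃ - f ≠ algebraMap F K b := by
    intro b hb
    have hb' : algebraMap F K b ≠ 0 := (map_ne_zero _).2 hb
    have key : f₃ - f ≠ algebraMap F K b := by
      intro e
      have e' := congrArg σ e
      have e'' := congrArg σ e'
      simp only [map_sub, AlgEquiv.commutes, hσ₃, ← hf₂, ← hf₃] at e' e''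
      exact mul_ne_zero h3K hb' (by linear_combination -e - e' - e'')
    refine ⟨fun e => key ?_, key⟩
    have e' := congrArg σ e
    rwa [map_sub, AlgEquiv.commutes, hσ₃, ← hf₃] at e'
  have e₄ : f₂ - f₃ ≠ 1 := by simpa using (e₃ 1 one_ne_zero).1
  have e₅ : f₂ - f₃ ≠ -1 := by simpa using (e₃ (-1) (neg_ne_zero.2 one_ne_zero)).1
  have e₆ : f₃ - f ≠ 1 := by simpa using (e₃ 1 one_ne_zero).2
  have e₇ : f₃ - f ≠ -1 := by simpa using (e₃ (-1) (neg_ne_zero.2 one_ne_zero)).2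
  have e₈ : f₃ ≠ 1 := by simpa using e₂ 1
  have e₉ : f₃ ≠ -1 := by simpa using e₂ (-1)
  refine isContained_of_norm_add_eq hF h3 ![0, f, f₂]
    (injective_three z₁.symm z₂.symm (sub_ne_zero.1 hg₁))
    ![f₃, f₃ + 1, f₃ - 1, f * f₂ / f₃, f₂ * (f₃ - f) / (f₂ - f₃), f * (f₂ - f₃) / (f₃ - f)]
    (injective_six ?_ ?_ ?_ ?_ ?_ ?_ ?_ ?_ ?_ ?_ ?_ ?_ ?_ ?_ ?_) ![a, -a, -a] ?_ ?_
  · exact fun e => one_ne_zero (α := K) (by linear_combination -e)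
  · exact fun e => one_ne_zero (α := K) (by linear_combination e)
  · rw [ne_eq, eq_div_iff z₃]
    exact fun e => e₁ (by linear_combination -e)
  · rw [ne_eq, eq_div_iff hg₂]
    exact fun e => e₁ (by linear_combination e)
  · rw [ne_eq, eq_div_iff hg₃]
    exact fun e => e₁ (by linear_combination -e)
  · exact fun e => h2 (by linear_combination e)
  · rw [ne_eq, eq_div_iff z₃]
    exact fun e => e₉ (by linear_combination e + hp)
  · rw [ne_eq, eq_div_iff hg₂]
    exact fun e => e₄ (by linear_combination e - hp)
  · rw [ne_eq, eq_div_iff hg₃]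
    exact fun e => e₇ (by linear_combination e + hp)
  · rw [ne_eq, eq_div_iff z₃]
    exact fun e => e₈ (by linear_combination -e - hp)
  · rw [ne_eq, eq_div_iff hg₂]
    exact fun e => e₅ (by linear_combination -e + hp)
  · rw [ne_eq, eq_div_iff hg₃]
    exact fun e => e₆ (by linear_combination -e - hp)
  · rw [ne_eq, div_eq_div_iff z₃ hg₂]
    exact fun e => e₁ (mul_left_cancel₀ z₂ (by linear_combination e))
  · rw [ne_eq, div_eq_div_iff z₃ hg₃]
    exact fun e => e₁ (mul_left_cancel₀ z₁ (by linear_combination -e))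
  · rw [ne_eq, div_eq_div_iff hg₂ hg₃]
    exact fun e => e₁ (mul_left_cancel₀ hg₁ (by linear_combination e))
  · intro i
    fin_cases i <;> simpa using ha0
  · intro i j
    fin_cases i <;> fin_cases j <;> simp [s₀, s₁, s₂, s₃, s₄, s₅]

end Generic

/-! ### Characteristic three -/

section CharThree

variable {F K : Type*} [Field F] [Field K] [Algebra F K]

/-- In characteristic three, for `σ f = f + 1`: the elements `e` such that `e` or `e⁻¹` is a
nonconstant linear polynomial in `f`. These linear polynomials have trace zero. -/
def IsLinearOrInv (F : Type*) {K : Type*} [Field F] [Field K] [Algebra F K] (f e : K) : Prop :=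
  ∃ α β : F, α ≠ 0 ∧
    (e = algebraMap F K α * f + algebraMap F K β ∨ e⁻¹ = algebraMap F K α * f + algebraMap F K β)

theorem mul_add_ne_zero_of_notMem {f : K} (hf : f ∉ Set.range (algebraMap F K)) {α : F}
    (hα : α ≠ 0) (β : F) : algebraMap F K α * f + algebraMap F K β ≠ 0 := by
  intro h
  have hα' : algebraMap F K α ≠ 0 := (map_ne_zero _).2 hα
  refine hf ⟨-β / α, ?_⟩
  rw [map_div₀, map_neg, div_eq_iff hα']
  linear_combination -h

/-- If `e` or `e⁻¹` has trace zero then `e + σ e` has norm `-N(e)`. -/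
theorem IsLinearOrInv.norm_apply_add [Module.Finite F K] {σ : K ≃ₐ[F] K}
    (h : IsCubicGenerator σ) (h3 : (3 : K) = 0) {f : K}
    (hf : f ∉ Set.range (algebraMap F K)) (hσ : σ f = f + 1) {e : K} (he : IsLinearOrInv F f e) :
    Algebra.norm F (σ e + e) = -Algebra.norm F e := by
  obtain ⟨α, β, hα, he⟩ := he
  obtain ⟨L, hL⟩ : ∃ L, L = algebraMap F K α * f + algebraMap F K β := ⟨_, rfl⟩
  have hL0 : L ≠ 0 := by rw [hL]; exact mul_add_ne_zero_of_notMem hf hα β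
  have htr : σ L + L = -σ (σ L) := by
    simp only [hL, map_add, map_mul, AlgEquiv.commutes, hσ, map_one]
    linear_combination (algebraMap F K α * f + algebraMap F K α + algebraMap F K β) * h3
  have hN : Algebra.norm F L ≠ 0 := Algebra.norm_ne_zero_iff.2 hL0
  rw [← hL] at he
  rcases he with rfl | he
  · rw [htr, h.norm_neg, h.norm_apply, h.norm_apply]
  · obtain rfl : e = L⁻¹ := by rw [← he, inv_inv]
    have hσL : σ L ≠ 0 := (map_ne_zero σ).2 hL0
    rw [show σ L⁻¹ + L⁻¹ = -(σ (σ L) / (L * σ L)) by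
      rw [map_inv₀]; field_simp; linear_combination htr, h.norm_neg, algebraNorm_div,
      map_mul, h.norm_apply, h.norm_apply, algebraNorm_inv]
    field_simp

theorem isContained_of_three_eq_zero [Finite F] (hF : 4 < Nat.card F)
    (h3 : Module.finrank F K = 3) (h3F : (3 : F) = 0) :
    (completeBipartiteGraph (Fin 4) (Fin 6)).IsContained (projNormGraph F K) := by
  have : Module.Finite F K := Module.finite_of_finrank_pos (by omega)
  obtain ⟨a, ha1, ha2, ha⟩ := exists_forall_cube_sub_self_ne_of_three_eq_zero hF h3F
  have ha0 : a ≠ 0 := fun h0 => ha 0 (by rw [h0]; ring)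
  obtain ⟨f, hfa, hf⟩ := exists_cube_sub_self_eq (K := K) h3 a ha
  have h3K : (3 : K) = 0 := by
    rw [← map_ofNat (algebraMap F K) 3, h3F, map_zero]
  -- the conjugates of `f` are `f`, `f + 1`, `f - 1`
  obtain ⟨σ, h, hσ⟩ : ∃ σ : K ≃ₐ[F] K, IsCubicGenerator σ ∧ σ f = f + 1 := by
    obtain ⟨σ, h⟩ := exists_isCubicGenerator (F := F) (K := K) h3
    have hq := h.sq_add_mul_add_sq hfa hf
    have hq' : (σ f - f - 1) * (σ f - f + 1) = 0 := by
      linear_combination hq - f * σ f * h3K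
    rcases mul_eq_zero.1 hq' with hσ | hσ
    · exact ⟨σ, h, by linear_combination hσ⟩
    · refine ⟨σ.trans σ, h.sq, ?_⟩
      rw [AlgEquiv.trans_apply, h.apply_apply_eq hfa hf]
      linear_combination -hσ - f * h3K
  have hp : a + 1 ≠ 0 := fun h0 => ha2 (by linear_combination h0)
  have hm : a - 1 ≠ 0 := sub_ne_zero.2 ha1
  have hpm : a ^ 2 - 1 ≠ 0 := by
    rw [show a ^ 2 - 1 = (a + 1) * (a - 1) by ring]; exact mul_ne_zero hp hm
  obtain ⟨A, hA⟩ : ∃ A, A = algebraMap F K a := ⟨_, rfl⟩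
  have hA0 : A ≠ 0 := by rw [hA]; exact (map_ne_zero _).2 ha0
  have hAp : A + 1 ≠ 0 := by
    rw [hA, ← map_one (algebraMap F K), ← map_add]; exact (map_ne_zero _).2 hp
  have hAm : A - 1 ≠ 0 := by
    rw [hA, ← map_one (algebraMap F K), ← map_sub]; exact (map_ne_zero _).2 hm
  rw [← hA] at hfa
  have hadd : ∀ s : F, f + algebraMap F K s ≠ 0 := fun s => by
    simpa using mul_add_ne_zero_of_notMem hf one_ne_zero s
  have hf0 : f ≠ 0 := by simpa using hadd 0
  have hfA : f - A ≠ 0 := by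
    have := hadd (-a)
    rwa [map_neg, ← sub_eq_add_neg, ← hA] at this
  -- the multiplier in the third equation `N(Z + d / σ d) = -1`
  obtain ⟨d, hd⟩ : ∃ d, d = f * (A - f) := ⟨_, rfl⟩
  have hd0 : d ≠ 0 := by
    rw [hd]; exact mul_ne_zero hf0 fun h0 => hfA (by linear_combination -h0)
  have hσd0 : σ d ≠ 0 := (map_ne_zero σ).2 hd0
  have hσd : σ d ≠ d := by
    simp only [hd, map_mul, map_sub, hσ, hA, AlgEquiv.commutes]
    intro e
    refine hf ⟨1 - a, ?_⟩
    rw [map_sub, map_one]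
    linear_combination -e - f * h3K
  have key : ∀ w, IsLinearOrInv F f w → IsLinearOrInv F f (d * w) →
      Algebra.norm F (σ w / w) = 1 ∧ Algebra.norm F (σ w / w + 1) = -1 ∧
      Algebra.norm F (σ w / w + d / σ d) = -1 := by
    intro w hw hdw
    have hw0 : w ≠ 0 := by
      rintro rfl
      obtain ⟨α, β, hα, h0⟩ := hw
      have := mul_add_ne_zero_of_notMem hf hα β
      rw [inv_zero, or_self] at h0
      exact this h0.symm
    have hNw : Algebra.norm F w ≠ 0 := Algebra.norm_ne_zero_iff.2 hw0
    have hNd : Algebra.norm F d ≠ 0 := Algebra.norm_ne_zero_iff.2 hd0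
    refine ⟨?_, ?_, ?_⟩
    · rw [algebraNorm_div, h.norm_apply, div_self hNw]
    · rw [show σ w / w + 1 = (σ w + w) / w by field_simp, algebraNorm_div,
        hw.norm_apply_add h h3K hf hσ, neg_div, div_self hNw]
    · rw [show σ w / w + d / σ d = (σ (d * w) + d * w) / (w * σ d) by
        rw [map_mul]; field_simp, algebraNorm_div, hdw.norm_apply_add h h3K hf hσ, map_mul,
        map_mul, h.norm_apply]
      field_simp
  -- the solutions `σ w / w` for `w = f + s` and `w = (f + s)⁻¹`
  have hS : ∀ s : F, f + algebraMap F K s + 1 ≠ 0 := fun s => by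
    have := hadd (s + 1)
    rwa [map_add, map_one, ← add_assoc] at this
  have hdir : ∀ s : F, IsLinearOrInv F f (d * (f + algebraMap F K s)) →
      Algebra.norm F ((f + algebraMap F K s + 1) / (f + algebraMap F K s)) = 1 ∧
      Algebra.norm F ((f + algebraMap F K s + 1) / (f + algebraMap F K s) + 1) = -1 ∧
      Algebra.norm F ((f + algebraMap F K s + 1) / (f + algebraMap F K s) + d / σ d) = -1 := by
    intro s hs
    have := key (f + algebraMap F K s) ⟨1, s, one_ne_zero, Or.inl (by simp)⟩ hs
    rwa [map_add, hσ, AlgEquiv.commutes, add_right_comm] at this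
  have hinv : ∀ s : F, IsLinearOrInv F f (d * (f + algebraMap F K s)⁻¹) →
      Algebra.norm F ((f + algebraMap F K s) / (f + algebraMap F K s + 1)) = 1 ∧
      Algebra.norm F ((f + algebraMap F K s) / (f + algebraMap F K s + 1) + 1) = -1 ∧
      Algebra.norm F ((f + algebraMap F K s) / (f + algebraMap F K s + 1) + d / σ d) = -1 := by
    intro s hs
    have := key (f + algebraMap F K s)⁻¹ ⟨1, s, one_ne_zero, Or.inr (by simp)⟩ hs
    rwa [map_inv₀, map_add, hσ, AlgEquiv.commutes, add_right_comm, inv_div_inv] at this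
  have c₀ := hdir a ⟨a ^ 2 - 1, -a, hpm, Or.inl (by
    simp only [map_sub, map_neg, map_pow, map_one, ← hA, hd]
    linear_combination -hfa)⟩
  -- `d (f + s) = d ((a ± 1) f - 1) / (a ± 1)` divides the norm of `d`, the cofactor being linear
  have hcof : d * ((A + 1) * f - 1) * ((A - 1) * f - 1) = A ^ 2 * (A ^ 2 + 1) := by
    rw [hd]
    linear_combination (-(A ^ 2 - 1) * f + A * (A ^ 2 + 1)) * hfa + (-A ^ 2 * f ^ 2 + A * f) * h3K
  have hL₁ : (A + 1) * f - 1 ≠ 0 := by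
    simpa [← hA, sub_eq_add_neg] using mul_add_ne_zero_of_notMem hf hp (-1)
  have hL₂ : (A - 1) * f - 1 ≠ 0 := by
    simpa [← hA, sub_eq_add_neg] using mul_add_ne_zero_of_notMem hf hm (-1)
  have hc0 : A ^ 2 + 1 ≠ 0 := by
    intro h0
    rw [h0, mul_zero] at hcof
    exact mul_ne_zero (mul_ne_zero hd0 hL₁) hL₂ hcof
  have hc : a ^ 2 + 1 ≠ 0 := by
    intro h0
    rw [hA, ← map_one (algebraMap F K), ← map_pow, ← map_add, h0, map_zero] at hc0
    exact hc0 rfl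
  have hApm : A ^ 2 - 1 ≠ 0 := by
    rw [show A ^ 2 - 1 = (A + 1) * (A - 1) by ring]; exact mul_ne_zero hAp hAm
  have hac : a ^ 2 * (a ^ 2 + 1) ≠ 0 := mul_ne_zero (pow_ne_zero 2 ha0) hc
  have c₁ := hdir (-(a + 1)⁻¹) ⟨(a + 1) * (a - 1) / (a ^ 2 * (a ^ 2 + 1)),
    -((a + 1) / (a ^ 2 * (a ^ 2 + 1))), div_ne_zero (mul_ne_zero hp hm) hac, Or.inr (by
      simp only [map_neg, map_inv₀, map_div₀, map_mul, map_add, map_sub, map_pow, map_one, ← hA]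
      refine inv_eq_of_mul_eq_one_right ?_
      field_simp
      linear_combination hcof)⟩
  have c₂ := hdir (-(a - 1)⁻¹) ⟨(a - 1) * (a + 1) / (a ^ 2 * (a ^ 2 + 1)),
    -((a - 1) / (a ^ 2 * (a ^ 2 + 1))), div_ne_zero (mul_ne_zero hm hp) hac, Or.inr (by
      simp only [map_neg, map_inv₀, map_div₀, map_mul, map_add, map_sub, map_pow, map_one, ← hA]
      refine inv_eq_of_mul_eq_one_right ?_
      field_simp
      linear_combination hcof)⟩
  have c₃ := hinv 0 ⟨-1, a, by simp, Or.inl (by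
    simp only [map_neg, map_zero, map_one, ← hA, hd, add_zero]
    field_simp; ring)⟩
  have c₄ := hinv (-a) ⟨-1, 0, by simp, Or.inl (by
    simp only [map_neg, map_zero, map_one, ← hA, hd, ← sub_eq_add_neg]
    field_simp; ring)⟩
  have c₅ := hinv (-(a / (a ^ 2 - 1))) ⟨(a ^ 2 - 1)⁻¹, a / (a ^ 2 - 1), by simp [hpm], Or.inr (by
    simp only [map_neg, map_inv₀, map_div₀, map_sub, map_pow, map_one, ← hA]
    rw [mul_inv, inv_inv, hd]
    have : A - f ≠ 0 := fun h0 => hfA (by linear_combination -h0)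
    field_simp
    linear_combination hfa)⟩
  -- equal quotients come from equal shifts, and the two families are disjoint as `2 f ∉ F`
  have d₁ : ∀ s t : F, s ≠ t → (f + algebraMap F K s + 1) / (f + algebraMap F K s) ≠
      (f + algebraMap F K t + 1) / (f + algebraMap F K t) := by
    intro s t hst
    rw [ne_eq, div_eq_div_iff (hadd s) (hadd t)]
    exact fun e => hst ((algebraMap F K).injective (by linear_combination -e))
  have d₂ : ∀ s t : F, s ≠ t → (f + algebraMap F K s) / (f + algebraMap F K s + 1) ≠
      (f + algebraMap F K t) / (f + algebraMap F K t + 1) := by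
    intro s t hst
    rw [ne_eq, div_eq_div_iff (hS s) (hS t)]
    exact fun e => hst ((algebraMap F K).injective (by linear_combination e))
  have d₃ : ∀ s t : F, (f + algebraMap F K s + 1) / (f + algebraMap F K s) ≠
      (f + algebraMap F K t) / (f + algebraMap F K t + 1) := by
    intro s t
    rw [ne_eq, div_eq_div_iff (hadd s) (hS t)]
    refine fun e => hf ⟨s + t + 1, ?_⟩
    rw [map_add, map_add, map_one]
    linear_combination e - f * h3K
  refine isContained_of_norm_add_eq hF h3 ![0, 1, d / σ d] (injective_three zero_ne_one
    (div_ne_zero hd0 hσd0).symm fun e => hσd (by rwa [eq_div_iff hσd0, one_mul] at e))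
    _ (injective_six (d₁ a (-(a + 1)⁻¹) ?_) (d₁ a (-(a - 1)⁻¹) ?_) (d₃ a 0) (d₃ a (-a))
      (d₃ a (-(a / (a ^ 2 - 1)))) (d₁ _ _ ?_) (d₃ _ _) (d₃ _ _) (d₃ _ _) (d₃ _ _) (d₃ _ _)
      (d₃ _ _) (d₂ _ _ ?_) (d₂ _ _ ?_) (d₂ _ _ ?_))
    ![1, -1, -1] ?_ ?_
  · intro e
    rw [eq_neg_iff_add_eq_zero] at e
    field_simp at e
    exact hm (pow_eq_zero_iff two_ne_zero |>.1 (by linear_combination e - a * h3F))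
  · intro e
    rw [eq_neg_iff_add_eq_zero] at e
    field_simp at e
    exact hp (pow_eq_zero_iff two_ne_zero |>.1 (by linear_combination e + a * h3F))
  · intro e
    rw [neg_inj, inv_inj] at e
    exact one_ne_zero (α := F) (by linear_combination h3F - e)
  · exact (neg_ne_zero.2 ha0).symm
  · exact (neg_ne_zero.2 (div_ne_zero ha0 hpm)).symm
  · intro e
    rw [neg_inj, eq_div_iff hpm] at e
    exact hc (mul_left_cancel₀ ha0 (by linear_combination e + a * h3F))
  · intro i
    fin_cases i <;> simp
  · have hcomb : ∀ z, Algebra.norm F z = 1 ∧ Algebra.norm F (z + 1) = -1 ∧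
        Algebra.norm F (z + d / σ d) = -1 →
        ∀ i, Algebra.norm F (z + (![0, 1, d / σ d] : Fin 3 → K) i) = (![1, -1, -1] : Fin 3 → F) i := by
      rintro z ⟨hz₀, hz₁, hz₂⟩ i
      fin_cases i
      · simpa using hz₀
      · exact hz₁
      · exact hz₂
    intro i j
    fin_cases j
    exacts [hcomb _ c₀ i, hcomb _ c₁ i, hcomb _ c₂ i, hcomb _ c₃ i, hcomb _ c₄ i, hcomb _ c₅ i]

end CharThree

/-! ### Characteristic two -/

section CharTwo

variable {F K : Type*} [Field F] [Field K] [Algebra F K]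

theorem isContained_of_two_eq_zero [Finite F] (hF : 4 < Nat.card F)
    (h3 : Module.finrank F K = 3) (h2F : (2 : F) = 0) :
    (completeBipartiteGraph (Fin 4) (Fin 6)).IsContained (projNormGraph F K) := by
  have : Module.Finite F K := Module.finite_of_finrank_pos (by omega)
  obtain ⟨σ, h⟩ := exists_isCubicGenerator (F := F) (K := K) h3
  obtain ⟨a, ha1, ha⟩ := exists_forall_cube_sub_self_ne_of_two_eq_zero hF h2F
  have ha0 : a ≠ 0 := fun h0 => ha 0 (by rw [h0]; ring)
  obtain ⟨f, hfa, hf⟩ := exists_cube_sub_self_eq (K := K) h3 a ha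
  have hN := h.norm_eq_of_cube_sub_self hfa hf
  have hq := h.sq_add_mul_add_sq hfa hf
  have hs := h.apply_apply_eq hfa hf
  have h2K : (2 : K) = 0 := by
    rw [← map_ofNat (algebraMap F K) 2, h2F, map_zero]
  -- the conjugates `g`, `g₂`, `g₃` of `f + 1` satisfy `g g₂ + g₂ g₃ + g₃ g = 0`
  obtain ⟨g, hg⟩ : ∃ g, g = f + 1 := ⟨_, rfl⟩
  obtain ⟨g₂, hg₂⟩ : ∃ g₂, g₂ = σ g := ⟨_, rfl⟩
  obtain ⟨g₃, hg₃⟩ : ∃ g₃, g₃ = σ g₂ := ⟨_, rfl⟩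
  have hσ₃ : σ g₃ = g := by rw [hg₃, hg₂, h.cube]
  have hf₂ : σ f = g₂ - 1 := by rw [hg₂, hg, map_add, map_one]; ring
  have hf₃ : σ (σ f) = g₃ - 1 := by rw [hf₂, map_sub, map_one, hg₃]
  obtain rfl : f = g - 1 := by rw [hg]; ring
  rw [hf₃, hf₂] at hs
  rw [hf₂] at hq
  have e₁ : g + g₂ + g₃ = 1 := by linear_combination hs + h2K
  have e₂ : g * g₂ + g₂ * g₃ + g₃ * g = 0 := by
    linear_combination -hq + (g + g₂) * e₁ + (1 - g - g₂) * h2K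
  have e₃ : g * g₂ * g₃ = algebraMap F K a := by
    rw [← hfa]
    linear_combination -g ^ 2 * e₁ + g * e₂ + (g ^ 2 - g) * h2K
  have z₁ : g ≠ 0 := fun h0 => hf ⟨-1, by simp [h0]⟩
  have z₂ : g₂ ≠ 0 := by rw [hg₂]; exact (map_ne_zero σ).2 z₁
  have z₃ : g₃ ≠ 0 := by rw [hg₃]; exact (map_ne_zero σ).2 z₂
  have hgF : ∀ b : F, g ≠ algebraMap F K b := fun b hb => hf ⟨b - 1, by rw [hb]; simp⟩
  have hg₂F : ∀ b : F, g₂ ≠ algebraMap F K b := fun b hb => hgF b (by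
    rw [← hσ₃, hg₃, hb, AlgEquiv.commutes, AlgEquiv.commutes])
  have hg₃F : ∀ b : F, g₃ ≠ algebraMap F K b := fun b hb => hgF b (by
    rw [← hσ₃, hb, AlgEquiv.commutes])
  have d₁₂ : g ≠ g₂ := by
    intro e
    obtain ⟨b, hb⟩ := h.fixed g (by rw [← hg₂, ← e])
    exact hgF b hb.symm
  have d₂₃ : g₂ ≠ g₃ := by rw [hg₃, hg₂]; exact fun e => d₁₂ (by rw [hg₂]; exact σ.injective e)
  have d₁₃ : g ≠ g₃ := by
    rw [← hσ₃, hg₃]; exact fun e => d₂₃ (by rw [hg₃]; exact (σ.injective e).symm)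
  -- the solutions in `F`: the root `r` of `r² + r = 1/a + 1` is a cyclic sum
  obtain ⟨r, hr⟩ : ∃ r, algebraMap F K r = g₃ / g + g / g₂ + g₂ / g₃ :=
    h.fixed _ (by simp only [map_add, map_div₀, hσ₃, ← hg₂, ← hg₃]; ring)
  have hra : r ^ 2 + r = 1 / a + 1 := by
    apply (algebraMap F K).injective
    -- with the numerator `M` of `r` and its mirror image `M'`, both `M + M'` and `M * M'` are
    -- symmetric polynomials
    obtain ⟨M, hM⟩ : ∃ M, M = g₃ ^ 2 * g₂ + g ^ 2 * g₃ + g₂ ^ 2 * g := ⟨_, rfl⟩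
    have hMM : M * ((g + g₂ + g₃) * (g * g₂ + g₂ * g₃ + g₃ * g) - 3 * (g * g₂ * g₃) - M) =
        (g * g₂ + g₂ * g₃ + g₃ * g) ^ 3 + (g + g₂ + g₃) ^ 3 * (g * g₂ * g₃) -
          6 * (g + g₂ + g₃) * (g * g₂ + g₂ * g₃ + g₃ * g) * (g * g₂ * g₃) +
          9 * (g * g₂ * g₃) ^ 2 := by
      rw [hM]
      ring
    rw [e₁, e₂] at hMM
    have hMP : M ^ 2 + M * (g * g₂ * g₃) = g * g₂ * g₃ + (g * g₂ * g₃) ^ 2 := by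
      linear_combination -hMM - (g * g₂ * g₃ * M + 5 * (g * g₂ * g₃) ^ 2 + g * g₂ * g₃) * h2K
    have hrM : algebraMap F K r = M / (g * g₂ * g₃) := by
      rw [hr, hM]
      field_simp
    have hP : g * g₂ * g₃ ≠ 0 := mul_ne_zero (mul_ne_zero z₁ z₂) z₃
    simp only [map_add, map_pow, map_div₀, map_one, hrM, ← e₃]
    generalize g * g₂ * g₃ = P at hMP hP
    field_simp
    linear_combination hMP
  have r0 : r ≠ 0 := by
    rintro rfl
    field_simp at hra
    exact ha1 (by linear_combination -hra - h2F)
  have r1 : r + 1 ≠ 0 := by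
    intro h0
    have : r * (r + 1) = 1 / a + 1 := by linear_combination hra
    rw [h0, mul_zero] at this
    field_simp at this
    exact ha1 (by linear_combination -this - h2F)
  have hinv : g⁻¹ + g₂⁻¹ + g₃⁻¹ = 0 := by
    field_simp
    linear_combination e₂
  have hNg : Algebra.norm F g = a := by simpa using hN 1
  -- the characteristic polynomial of `g⁻¹`
  have hNb : ∀ b : F, b ≠ 0 → Algebra.norm F (algebraMap F K b + g⁻¹) =
      b ^ 3 + b * a⁻¹ + a⁻¹ := by
    intro b hb
    have hb' : algebraMap F K b ≠ 0 := (map_ne_zero _).2 hb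
    rw [show algebraMap F K b + g⁻¹ =
      algebraMap F K b * (g - 1 + algebraMap F K (1 + b⁻¹)) / g by
        rw [map_add, map_inv₀, map_one]; field_simp; ring,
      algebraNorm_div, map_mul, Algebra.norm_algebraMap, h3, hN, hNg]
    field_simp
    linear_combination (b ^ 2 + b) * h2F
  have hconj : ∀ b : F, Algebra.norm F (algebraMap F K b + g⁻¹) = 1 →
      Algebra.norm F (algebraMap F K b + g₂⁻¹) = 1 ∧
      Algebra.norm F (algebraMap F K b + g₃⁻¹) = 1 := by
    intro b hb
    have hb₂ : Algebra.norm F (algebraMap F K b + g₂⁻¹) = 1 := by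
      rw [← hb, ← h.norm_apply (_ + g⁻¹), map_add σ, AlgEquiv.commutes, map_inv₀ σ, ← hg₂]
    refine ⟨hb₂, ?_⟩
    rw [← hb₂, ← h.norm_apply (_ + g₂⁻¹), map_add σ, AlgEquiv.commutes, map_inv₀ σ, ← hg₃]
  have b₀ : Algebra.norm F (1 + g⁻¹) = 1 := by
    have := hNb 1 one_ne_zero
    rw [map_one] at this
    rw [this]; linear_combination a⁻¹ * h2F
  have b₁ : Algebra.norm F (algebraMap F K r + g⁻¹) = 1 := by
    rw [hNb r r0]
    linear_combination -(r + 1) * hra + (r ^ 3 + r ^ 2 - 1) * h2F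
  have b₂ : Algebra.norm F (algebraMap F K r + 1 + g⁻¹) = 1 := by
    have := hNb (r + 1) r1
    rw [map_add (algebraMap F K), map_one] at this
    rw [this]
    linear_combination -(r + 2) * hra + (r ^ 3 + 3 * r ^ 2 + 2 * r - 1) * h2F
  have b₀' := hconj 1 (by rwa [map_one])
  have b₁' := hconj r b₁
  have b₂' := hconj (r + 1) (by rwa [map_add (algebraMap F K), map_one])
  rw [map_one] at b₀'
  rw [map_add (algebraMap F K), map_one] at b₂'
  have dbl : ∀ x : K, 1 + x + x = 1 := fun x => by linear_combination x * h2K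
  have s₁₂ : 1 + g⁻¹ + g₂⁻¹ = 1 + g₃⁻¹ := by linear_combination hinv - g₃⁻¹ * h2K
  have s₁₃ : 1 + g⁻¹ + g₃⁻¹ = 1 + g₂⁻¹ := by linear_combination hinv - g₂⁻¹ * h2K
  have s₂₃ : 1 + g₂⁻¹ + g₃⁻¹ = 1 + g⁻¹ := by linear_combination hinv - g⁻¹ * h2K
  have s₂₁ : 1 + g₂⁻¹ + g⁻¹ = 1 + g₃⁻¹ := by linear_combination s₁₂
  have s₃₁ : 1 + g₃⁻¹ + g⁻¹ = 1 + g₂⁻¹ := by linear_combination s₁₃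
  have s₃₂ : 1 + g₃⁻¹ + g₂⁻¹ = 1 + g⁻¹ := by linear_combination s₂₃
  -- an element of `F` is not of the form `1 + c` with `c` the inverse of a conjugate of `g`
  have hne : ∀ x : K, (∀ b : F, x ≠ algebraMap F K b) → ∀ b : F, algebraMap F K b ≠ 1 + x⁻¹ := by
    intro x hx b hb
    refine hx (b - 1)⁻¹ ?_
    rw [map_inv₀, map_sub, map_one, hb]
    simp
  have hne₁ := hne g hgF
  have hne₂ := hne g₂ hg₂F
  have hne₃ := hne g₃ hg₃F
  have hadd : ∀ x y : K, x ≠ y → 1 + x⁻¹ ≠ 1 + y⁻¹ := fun x y hxy e =>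
    hxy (inv_injective (add_right_injective _ e))
  refine isContained_of_norm_add_eq hF h3 ![g⁻¹, g₂⁻¹, g₃⁻¹]
    (injective_three (inv_injective.ne d₁₂) (inv_injective.ne d₁₃) (inv_injective.ne d₂₃))
    ![1, algebraMap F K r, algebraMap F K r + 1, 1 + g⁻¹, 1 + g₂⁻¹, 1 + g₃⁻¹]
    (injective_six ?_ ?_ ?_ ?_ ?_ ?_ (hne₁ r) (hne₂ r) (hne₃ r) ?_ ?_ ?_
      (hadd _ _ d₁₂) (hadd _ _ d₁₃) (hadd _ _ d₂₃)) ![1, 1, 1] ?_ ?_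
  · rw [← map_one (algebraMap F K)]
    exact fun e => r1 (by linear_combination h2F - (algebraMap F K).injective e)
  · rw [← map_one (algebraMap F K), ← map_add]
    exact fun e => r0 (by linear_combination -(algebraMap F K).injective e)
  · simpa using hne₁ 1
  · simpa using hne₂ 1
  · simpa using hne₃ 1
  · simp
  · simpa using hne₁ (r + 1)
  · simpa using hne₂ (r + 1)
  · simpa using hne₃ (r + 1)
  · intro i
    fin_cases i <;> simp
  · intro i j
    fin_cases i <;> fin_cases j <;> simp [b₀, b₁, b₂, b₀', b₁', b₂', dbl, s₁₂, s₁₃, s₂₃, s₂₁, s₃₁, s₃₂]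

end CharTwo

/-! ### All finite fields with more than four elements -/

theorem isContained_of_four_lt_card {F K : Type*} [Field F] [Field K] [Algebra F K]
    (hF : 4 < Nat.card F) (h3 : Module.finrank F K = 3) :
    (completeBipartiteGraph (Fin 4) (Fin 6)).IsContained (projNormGraph F K) := by
  have : Finite F := Nat.finite_of_card_ne_zero (by omega)
  by_cases h2F : (2 : F) = 0
  · exact isContained_of_two_eq_zero hF h3 h2F
  · by_cases h3F : (3 : F) = 0
    · exact isContained_of_three_eq_zero hF h3 h3F
    · exact isContained_of_two_ne_zero_of_three_ne_zero hF h3 h2F h3F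

theorem theorem3 :
    -- `NG(q, 4)` contains `K_{4,6}` whenever `q = p ^ k > 4` with `p` a prime, `p ≢ 1 (mod 3)`
    (∀ q p k : ℕ, p.Prime → ¬ p ≡ 1 [MOD 3] → q = p ^ k → 4 < q →
      ∀ (F : Type*) (K : Type*) [Field F] [Field K] [Algebra F K],
        Nat.card F = q → Module.finrank F K = 3 →
          (completeBipartiteGraph (Fin 4) (Fin 6)).IsContained (projNormGraph F K)) ∧
    -- in particular `NG(2 ^ k, 4)` does for every `k ≥ 3`
    (∀ k : ℕ, 3 ≤ k →
      ∀ (F : Type*) (K : Type*) [Field F] [Field K] [Algebra F K],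
        Nat.card F = 2 ^ k → Module.finrank F K = 3 →
          (completeBipartiteGraph (Fin 4) (Fin 6)).IsContained (projNormGraph F K)) ∧
    -- and `NG(3 ^ l, 4)` does for every `l ≥ 2`
    (∀ l : ℕ, 2 ≤ l →
      ∀ (F : Type*) (K : Type*) [Field F] [Field K] [Algebra F K],
        Nat.card F = 3 ^ l → Module.finrank F K = 3 →
          (completeBipartiteGraph (Fin 4) (Fin 6)).IsContained (projNormGraph F K)) := by
  refine ⟨fun q p k _ _ _ hq F K _ _ _ hF h3 => isContained_of_four_lt_card (hF ▸ hq) h3,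
    fun k hk F K _ _ _ hF h3 => isContained_of_four_lt_card ?_ h3,
    fun l hl F K _ _ _ hF h3 => isContained_of_four_lt_card ?_ h3⟩
  · rw [hF]
    exact lt_of_lt_of_le (by norm_num) (Nat.pow_le_pow_right two_pos hk)
  · rw [hF]
    exact lt_of_lt_of_le (by norm_num) (Nat.pow_le_pow_right three_pos hl)
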